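/- Let $(X,\mathcal B,p)$ be a non-atomic Lebesgue probability space (a standard Borel space with a non-atomic probability measure; sets are taken measurable with respect to the completion of $p$), and let $m\ge 2$ be an integer. Let $A_1,\dots,A_m$ be pairwise disjoint measurable sets with $p(A_1\cup\dots\cup A_m)=1$, let $a_1,\dots,a_m\in\mathbb R$, and suppose that $f=\sum_{i=1}^m a_i 1_{A_i}$ almost everywhere and $\int f\,dp=0$. Assume that the numbers $p(A_1),\dots,p(A_{m-1})$ are rationally independent modulo $1$, i.e. that $1,p(A_1),\dots,p(A_{m-1})$ are linearly independent over $\mathbb Q$. Then there is an ergodic invertible measure-preserving transformation $\tau$ of $(X,\mathcal B,p)$ such that: (i) $\tau$ is isomorphic, modulo null sets, to a translation $x\mapsto x+\theta$ of the $(m-1)$-dimensional torus $(\mathbb R/\mathbb Z)^{m-1}$ with normalized Lebesgue measure; (ii) $f$ is a $\tau$-coboundary with bounded transfer function: there is $h\in L_\infty(X,p)$ with $f=h-h\circ\tau$ almost everywhere. -/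

import Mathlib

open MeasureTheory

/-- The real numbers `α 0, …, α (d - 1)` are rationally independent in the sense used for
translations of tori (independence modulo `1`): `1, α 0, …, α (d - 1)` are linearly independent
over `ℚ`. -/
def RationallyIndependent {d : ℕ} (α : Fin d → ℝ) : Prop :=
  LinearIndependent ℚ (Fin.cons 1 α : Fin (d + 1) → ℝ)

/-- `f` is a `τ`-coboundary with a transfer function in `L_s(p)`: there is `h ∈ L_s(p)` with
`f = h - h ∘ τ` almost everywhere. -/
def IsCoboundary {X : Type*} [MeasurableSpace X] (p : Measure X) (τ : X → X)
    (s : ENNReal) (f : X → ℝ) : Prop :=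
  ∃ h : X → ℝ, MemLp h s p ∧ ∀ᵐ x ∂p, f x = h x - h (τ x)

/-- The measure-preserving systems `(X, μ, T)` and `(Y, ν, S)` are isomorphic (modulo null sets):
there are measure-preserving maps `φ : X → Y` and `ψ : Y → X`, inverse to each other almost
everywhere, such that `φ` intertwines `T` and `S` almost everywhere. -/
def IsIsomorphicMod0 {X Y : Type*} [MeasurableSpace X] [MeasurableSpace Y]
    (μ : Measure X) (T : X → X) (ν : Measure Y) (S : Y → Y) : Prop :=
  ∃ (φ : X → Y) (ψ : Y → X),
    MeasurePreserving φ μ ν ∧ MeasurePreserving ψ ν μ ∧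
    (∀ᵐ x ∂μ, ψ (φ x) = x) ∧ (∀ᵐ y ∂ν, φ (ψ y) = y) ∧
    (∀ᵐ x ∂μ, φ (T x) = S (φ x))

/-- The `d`-dimensional torus `(ℝ / ℤ)^d`; its `volume` is normalized Lebesgue (Haar) measure. -/
abbrev Torus (d : ℕ) : Type := Fin d → UnitAddCircle

/-!
The transformation is found on the torus and transported to `X`.

Let `α i = p (A i)` for `i < d`, and let `T` be the translation of the torus by `α` modulo `1`.
The torus is partitioned into `d + 1` sets `B i` such that `1_{B i} - α i` is, for `i < d`, the
coboundary of a bounded function `h i` (`exists_bounded_remainder_partition`). The functions are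
explicit. With `σ i = h 0 + ⋯ + h (i - 1)` and `c i = α i / (1 - (α 0 + ⋯ + α (i - 1)))`, put
`h i x = fract (x i + c i * σ i x) - c i * σ i x`. Suppose that `h 0, …, h (i - 1)` change along a
step of `T` by `α j - 1_{B j}` each. If none of the sets `B 0, …, B (i - 1)` contains `x`, the
step increases `σ i` by `α 0 + ⋯ + α (i - 1)`, hence the argument of `fract` by exactly `c i ∈ [0, 1]`,
and the circle is wrapped around at most once: the point is put into `B i` if this happens. If one of these
sets contains `x`, the increase of `σ i` is smaller by `1`, and the argument of `fract` does not
change at all, so that `B i` is disjoint from the previous sets. What is left over is `B d`.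

Integrating the coboundary equations shows that `B i` has measure `p (A i)`. Since `∫ f = 0`, the
function with the value `a i` on `B i` is the coboundary of a linear combination of the `h i`.

Rational independence makes `T` ergodic: a measure invariant under `T` integrates all nontrivial
characters to `0`, so it is a multiple of Haar measure, and this is applied to the restriction of
Haar measure to an invariant set (`ergodic_translation`). Finally, atomless standard Borel measure
spaces of equal positive mass are isomorphic (`exists_measurableEquiv_of_measure_univ_eq`). Applied
to every pair `A i`, `B i`, which have positive mass by rational independence, this gives a
measurable equivalence `φ` from `X` to the torus that takes `A i` to `B i` up to null sets, and
`τ = φ⁻¹ ∘ T ∘ φ`.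
-/

/-! ### A partition of the torus into bounded remainder sets -/

/-- The representative in `[0, 1)` of a point of the circle `ℝ / ℤ`. -/
noncomputable def circleFract (x : UnitAddCircle) : ℝ := (AddCircle.equivIco 1 0 x : ℝ)

lemma circleFract_nonneg (x : UnitAddCircle) : 0 ≤ circleFract x :=
  (AddCircle.equivIco 1 0 x).2.1

lemma circleFract_lt_one (x : UnitAddCircle) : circleFract x < 1 :=
  (AddCircle.equivIco 1 0 x).2.2.trans_eq (zero_add 1)

lemma circleFract_coe (t : ℝ) : circleFract (t : UnitAddCircle) = Int.fract t := by
  simp [circleFract]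

lemma coe_circleFract (x : UnitAddCircle) : ((circleFract x : ℝ) : UnitAddCircle) = x :=
  AddCircle.coe_equivIco

lemma circleFract_add_coe (x : UnitAddCircle) (t : ℝ) :
    circleFract (x + t) = Int.fract (circleFract x + t) := by
  rw [← circleFract_coe, AddCircle.coe_add, coe_circleFract]

lemma measurable_circleFract : Measurable circleFract :=
  measurable_subtype_coe.comp (AddCircle.measurableEquivIco 1 0).measurable

/-- Moving a point of the circle by `t ∈ [0, 1]` wraps around the circle at most once. -/
lemma circleFract_add_coe_eq_or (x : UnitAddCircle) {t : ℝ} (h0 : 0 ≤ t) (h1 : t ≤ 1) :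
    circleFract (x + t) = circleFract x + t ∨ circleFract (x + t) = circleFract x + t - 1 := by
  rw [circleFract_add_coe]
  have hx0 := circleFract_nonneg x
  have hx1 := circleFract_lt_one x
  rcases lt_or_ge (circleFract x + t) 1 with h | h
  · left
    exact Int.fract_eq_self.2 ⟨by linarith, h⟩
  · right
    rw [← Int.fract_sub_one]
    exact Int.fract_eq_self.2 ⟨by linarith, by linarith⟩

/-- The conditional frequency of the symbol `k`, given that none of the symbols `j < k` occurs,
when the symbol `j` has frequency `p j`. -/
noncomputable def conditionalFrequency (p : ℕ → ℝ) (k : ℕ) : ℝ :=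
  p k / (1 - ∑ j ∈ Finset.range k, p j)

/-- The sum of the first `k` transfer functions. The transfer function of the symbol `k` is the
sawtooth `h k x = fract (x k + c * σ) - c * σ`, where `c` is the conditional frequency of `k`
and `σ` is the sum of the transfer functions of the previous symbols. -/
noncomputable def transferSum (p : ℕ → ℝ) (x : ℕ → UnitAddCircle) : ℕ → ℝ
  | 0 => 0
  | k + 1 => transferSum p x k +
      (circleFract (x k + ((conditionalFrequency p k * transferSum p x k : ℝ) : UnitAddCircle)) -
        conditionalFrequency p k * transferSum p x k)

lemma measurable_transferSum (p : ℕ → ℝ) (k : ℕ) : Measurable fun x => transferSum p x k := by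
  induction k with
  | zero => simp [transferSum]
  | succ k ih =>
    have h1 : Measurable fun x => conditionalFrequency p k * transferSum p x k := ih.const_mul _
    have h2 : Measurable fun x : ℕ → UnitAddCircle =>
        x k + ((conditionalFrequency p k * transferSum p x k : ℝ) : UnitAddCircle) :=
      (measurable_pi_apply k).add (AddCircle.measurable_mk'.comp h1)
    exact ih.add ((measurable_circleFract.comp h2).sub h1)

lemma exists_abs_transferSum_le (p : ℕ → ℝ) (k : ℕ) : ∃ C, ∀ x, |transferSum p x k| ≤ C := by
  induction k with
  | zero => exact ⟨0, fun x => by simp [transferSum]⟩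
  | succ k ih =>
    obtain ⟨C, hC⟩ := ih
    refine ⟨C + (1 + |conditionalFrequency p k| * C), fun x => ?_⟩
    refine (abs_add_le _ _).trans (add_le_add (hC x) ((abs_sub _ _).trans (add_le_add ?_ ?_)))
    · rw [abs_of_nonneg (circleFract_nonneg _)]
      exact (circleFract_lt_one _).le
    · rw [abs_mul]
      exact mul_le_mul_of_nonneg_left (hC x) (abs_nonneg _)

section

variable {p : ℕ → ℝ} {x : ℕ → UnitAddCircle} {k : ℕ}

/-- The symbol of a step is below `k` if and only if the increment of `transferSum` at `k` is one
less than `∑ j < k, p j`. If no symbol below `k` has occurred, the argument of the sawtooth `k` grows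
by the conditional frequency, so the symbol `k` occurs or not. -/
lemma transferSum_succ_of_eq (hp : 0 < p k) (hs : ∑ j ∈ Finset.range (k + 1), p j ≤ 1)
    (h : transferSum p (fun j => x j + (p j : UnitAddCircle)) k - transferSum p x k =
      ∑ j ∈ Finset.range k, p j) :
    transferSum p (fun j => x j + (p j : UnitAddCircle)) (k + 1) - transferSum p x (k + 1) =
        ∑ j ∈ Finset.range (k + 1), p j ∨
      transferSum p (fun j => x j + (p j : UnitAddCircle)) (k + 1) - transferSum p x (k + 1) =
        ∑ j ∈ Finset.range (k + 1), p j - 1 := by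
  rw [Finset.sum_range_succ] at hs ⊢
  have hc : conditionalFrequency p k * (1 - ∑ j ∈ Finset.range k, p j) = p k :=
    div_mul_cancel₀ _ (by linarith)
  have hc0 : 0 ≤ conditionalFrequency p k := div_nonneg hp.le (by linarith)
  have hc1 : conditionalFrequency p k ≤ 1 := div_le_one_of_le₀ (by linarith) (by linarith)
  simp only [transferSum]
  set c := conditionalFrequency p k
  set σ := transferSum p x k
  set P := ∑ j ∈ Finset.range k, p j
  rw [show transferSum p (fun j => x j + (p j : UnitAddCircle)) k = σ + P by linarith]
  have harg : x k + (p k : UnitAddCircle) + ((c * (σ + P) : ℝ) : UnitAddCircle) =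
      x k + ((c * σ : ℝ) : UnitAddCircle) + (c : UnitAddCircle) := by
    rw [add_assoc, add_assoc, ← AddCircle.coe_add, ← AddCircle.coe_add]
    congr 2
    linear_combination -hc
  rw [harg]
  rcases circleFract_add_coe_eq_or (x k + ((c * σ : ℝ) : UnitAddCircle)) hc0 hc1 with h' | h'
  · left
    rw [h']
    linear_combination hc
  · right
    rw [h']
    linear_combination hc

/-- If a symbol below `k` has occurred in a step, the argument of the sawtooth `k` does not change,
and the symbol `k` does not occur. -/
lemma transferSum_succ_of_eq_sub_one (hp : 0 < p k) (hs : ∑ j ∈ Finset.range (k + 1), p j ≤ 1)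
    (h : transferSum p (fun j => x j + (p j : UnitAddCircle)) k - transferSum p x k =
      ∑ j ∈ Finset.range k, p j - 1) :
    transferSum p (fun j => x j + (p j : UnitAddCircle)) (k + 1) - transferSum p x (k + 1) =
      ∑ j ∈ Finset.range (k + 1), p j - 1 := by
  rw [Finset.sum_range_succ] at hs ⊢
  have hc : conditionalFrequency p k * (1 - ∑ j ∈ Finset.range k, p j) = p k :=
    div_mul_cancel₀ _ (by linarith)
  simp only [transferSum]
  set c := conditionalFrequency p k
  set σ := transferSum p x k
  set P := ∑ j ∈ Finset.range k, p j
  rw [show transferSum p (fun j => x j + (p j : UnitAddCircle)) k = σ + P - 1 by linarith]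
  have harg : x k + (p k : UnitAddCircle) + ((c * (σ + P - 1) : ℝ) : UnitAddCircle) =
      x k + ((c * σ : ℝ) : UnitAddCircle) := by
    rw [add_assoc, ← AddCircle.coe_add]
    congr 2
    linear_combination -hc
  rw [harg]
  linear_combination hc

lemma transferSum_sub_eq_or {d : ℕ} (hp : ∀ k < d, 0 < p k)
    (hs : ∀ k ≤ d, ∑ j ∈ Finset.range k, p j ≤ 1) (hk : k ≤ d) :
    transferSum p (fun j => x j + (p j : UnitAddCircle)) k - transferSum p x k =
        ∑ j ∈ Finset.range k, p j ∨
      transferSum p (fun j => x j + (p j : UnitAddCircle)) k - transferSum p x k =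
        ∑ j ∈ Finset.range k, p j - 1 := by
  induction k with
  | zero => simp [transferSum]
  | succ k ih =>
    rcases ih (by lia) with h | h
    · exact transferSum_succ_of_eq (hp k hk) (hs _ hk) h
    · exact Or.inr (transferSum_succ_of_eq_sub_one (hp k hk) (hs _ hk) h)

end

/-- For a torus translation with coordinates `p i`, where the `p i` are positive with sum at most
`1`, there is a partition (given by the labelling `ℓ`) of the torus into `d + 1` sets, such that
the indicator function of the `i`-th set minus `p i` is the coboundary of a bounded function. -/
theorem exists_bounded_remainder_partition {d : ℕ} (p : Fin d → ℝ) (hp : ∀ i, 0 < p i)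
    (hs : ∑ i, p i ≤ 1) :
    ∃ (ℓ : Torus d → Fin (d + 1)) (h : Fin d → Torus d → ℝ),
      Measurable ℓ ∧ (∀ i, Measurable (h i)) ∧ (∀ i, ∃ C, ∀ x, |h i x| ≤ C) ∧
      ∀ i x, (ℓ ⁻¹' {i.castSucc}).indicator (1 : Torus d → ℝ) x =
        p i + h i x - h i (x + fun j => (p j : UnitAddCircle)) := by
  classical
  set q : ℕ → ℝ := fun k => if hk : k < d then p ⟨k, hk⟩ else 0 with hq
  let y : Torus d → ℕ → UnitAddCircle := fun x k => if hk : k < d then x ⟨k, hk⟩ else 0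
  have hqp : ∀ i : Fin d, q i = p i := fun i => by simp [hq]
  have hq0 : ∀ k, 0 ≤ q k := fun k => by
    simp only [hq]; split_ifs with hk
    exacts [(hp _).le, le_rfl]
  have hqd : ∑ j ∈ Finset.range d, q j = ∑ i, p i := by
    rw [← Fin.sum_univ_eq_sum_range]; exact Finset.sum_congr rfl fun i _ => hqp i
  have hqs : ∀ k ≤ d, ∑ j ∈ Finset.range k, q j ≤ 1 := fun k hk =>
    (Finset.sum_le_sum_of_subset_of_nonneg (Finset.range_mono hk) fun j _ _ => hq0 j).trans
      (hqd.le.trans hs)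
  have hqpos : ∀ k < d, 0 < q k := fun k hk => by simp [hq, hk, hp]
  have hy : ∀ x : Torus d, y (x + fun j => (p j : UnitAddCircle)) =
      fun j => y x j + (q j : UnitAddCircle) := fun x => by
    funext k
    by_cases hk : k < d <;> simp [y, hq, hk]
  have hymeas : Measurable y := by
    refine measurable_pi_lambda _ fun k => ?_
    by_cases hk : k < d
    · simpa [y, hk] using measurable_pi_apply _
    · simp [y, hk]
  let h : Fin d → Torus d → ℝ := fun i x =>
    transferSum q (y x) (i + 1) - transferSum q (y x) i
  -- `e i x` is `1` if the step from `x` has the symbol `i`, and `0` otherwise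
  let e : Fin d → Torus d → ℝ := fun i x =>
    p i + h i x - h i (x + fun j => (p j : UnitAddCircle))
  have hhm : ∀ i, Measurable (h i) := fun i =>
    ((measurable_transferSum q (i + 1)).comp hymeas).sub
      ((measurable_transferSum q i).comp hymeas)
  have hem : ∀ i, Measurable (e i) := fun i =>
    ((hhm i).const_add _).sub ((hhm i).comp (measurable_add_const _))
  have he : ∀ i x, e i x = 0 ∨ e i x = 1 := fun i x => by
    simp only [e, h, hy]
    have hstep := Finset.sum_range_succ q i
    rw [hqp] at hstep
    rcases transferSum_sub_eq_or (x := y x) hqpos hqs i.2.le with h1 | h1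
    · rcases transferSum_succ_of_eq (hqpos i i.2) (hqs _ i.2) h1 with h2 | h2
      · left; linarith
      · right; linarith
    · have h2 := transferSum_succ_of_eq_sub_one (hqpos i i.2) (hqs _ i.2) h1
      left; linarith
  have hesum : ∀ x, ∑ i, e i x ≤ 1 := fun x => by
    -- the transfer functions telescope
    have htel : ∀ z : ℕ → UnitAddCircle, ∑ i : Fin d,
        (transferSum q z (i + 1) - transferSum q z i) = transferSum q z d := fun z => by
      rw [Fin.sum_univ_eq_sum_range (fun i => transferSum q z (i + 1) - transferSum q z i) d,
        Finset.sum_range_sub]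
      simp [transferSum]
    simp only [e, h, hy, Finset.sum_sub_distrib, Finset.sum_add_distrib] at htel ⊢
    have h1 := htel (y x)
    have h2 := htel (fun j => y x j + (q j : UnitAddCircle))
    rcases transferSum_sub_eq_or (x := y x) hqpos hqs le_rfl with h3 | h3 <;> linarith
  have hlabel : ∀ x, ∃ l : Fin (d + 1), ∀ i : Fin d,
      (if l = i.castSucc then (1 : ℝ) else 0) = e i x := fun x => by
    by_cases hx : ∃ i, e i x = 1
    · obtain ⟨i, hi⟩ := hx
      refine ⟨i.castSucc, fun j => ?_⟩
      by_cases hij : i = j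
      · simp [← hij, hi]
      · have h1 := Finset.add_le_sum (s := Finset.univ) (f := fun i => e i x)
          (fun k _ => by rcases he k x with h | h <;> simp [h])
          (Finset.mem_univ i) (Finset.mem_univ j) hij
        have h2 := hesum x
        rcases he j x with h | h
        · simp [h, hij]
        · simp only [hi, h] at h1; linarith
    · push Not at hx
      refine ⟨Fin.last d, fun j => ?_⟩
      rw [(he j x).resolve_right (hx j), if_neg (Fin.castSucc_lt_last j).ne']
  choose ℓ hℓ using hlabel
  refine ⟨ℓ, h, ?_, hhm, fun i => ?_, fun i x => ?_⟩
  · have hpre : ∀ i : Fin d, MeasurableSet (ℓ ⁻¹' {i.castSucc}) := fun i => by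
      convert hem i (measurableSet_singleton 1) using 1
      ext x
      simp only [Set.mem_preimage, Set.mem_singleton_iff, ← hℓ x i]
      split_ifs with h <;> simp [h]
    refine measurable_to_countable' fun l => ?_
    refine Fin.lastCases ?_ hpre l
    convert MeasurableSet.iInter fun i => (hpre i).compl using 1
    ext x
    simp only [Set.mem_preimage, Set.mem_singleton_iff, Set.mem_iInter, Set.mem_compl_iff]
    refine ⟨fun h i => h ▸ (Fin.castSucc_lt_last i).ne', fun h => ?_⟩
    by_contra hne
    obtain ⟨i, hi⟩ := Fin.exists_castSucc_eq.2 hne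
    exact h i hi.symm
  · obtain ⟨C, hC⟩ := exists_abs_transferSum_le q (i + 1)
    obtain ⟨C', hC'⟩ := exists_abs_transferSum_le q i
    exact ⟨C + C', fun x => (abs_sub _ _).trans (add_le_add (hC _) (hC' _))⟩
  · refine Eq.trans ?_ (hℓ x i)
    by_cases h : ℓ x = i.castSucc <;> simp [h]

/-! ### Ergodicity of irrational torus translations -/

instance instIsProbabilityMeasureUnitAddCircle :
    IsProbabilityMeasure (volume : Measure UnitAddCircle) :=
  ⟨UnitAddCircle.measure_univ⟩

instance instNullSingletonClassUnitAddCircle :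
    NullSingletonClass (volume : Measure UnitAddCircle) := by
  refine ⟨fun x => ?_⟩
  have h := AddCircle.volume_closedBall (T := 1) (x := x) 0
  simpa using h

/-- A character of the torus at the point with coordinates `α`. -/
lemma mFourier_coe {d : ℕ} (n : Fin d → ℤ) (α : Fin d → ℝ) :
    UnitAddTorus.mFourier n (fun i => (α i : UnitAddCircle)) =
      Complex.exp (2 * Real.pi * Complex.I * ((∑ i, n i * α i : ℝ) : ℂ)) := by
  simp only [UnitAddTorus.mFourier, ContinuousMap.coe_mk, fourier_coe_apply, ← Complex.exp_sum]
  congr 1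
  push_cast
  rw [Finset.mul_sum]
  exact Finset.sum_congr rfl fun i _ => by ring

/-- A nontrivial character does not take the value `1` at a rationally independent point. -/
lemma mFourier_coe_ne_one {d : ℕ} {α : Fin d → ℝ} (hα : RationallyIndependent α)
    {n : Fin d → ℤ} (hn : n ≠ 0) :
    UnitAddTorus.mFourier n (fun i => (α i : UnitAddCircle)) ≠ 1 := by
  rw [mFourier_coe]
  intro h
  obtain ⟨m, hm⟩ := Complex.exp_eq_one_iff.1 h
  have hpi : (2 * Real.pi * Complex.I : ℂ) ≠ 0 := Complex.two_pi_I_ne_zero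
  have hm' : (∑ i, n i * α i : ℝ) = m := by
    rw [mul_comm (m : ℂ)] at hm
    exact_mod_cast mul_left_cancel₀ hpi hm
  apply hn
  have h0 := Fintype.linearIndependent_iff.1 hα (Fin.cons (-(m : ℚ)) fun i => (n i : ℚ)) (by
    rw [Fin.sum_univ_succ]
    simp [Rat.smul_def, hm'])
  funext i
  simpa using h0 i.succ

lemma mFourier_add_apply {d : ℕ} (n : Fin d → ℤ) (x y : Torus d) :
    UnitAddTorus.mFourier n (x + y) = UnitAddTorus.mFourier n x * UnitAddTorus.mFourier n y := by
  simp [UnitAddTorus.mFourier, fourier_apply, smul_add, AddCircle.toCircle_add,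
    Finset.prod_mul_distrib]

/-- Nontrivial characters have integral zero for every measure invariant under an irrational
translation. -/
lemma integral_mFourier_eq_zero {d : ℕ} {α : Fin d → ℝ} (hα : RationallyIndependent α)
    {ν : Measure (Torus d)}
    (hν : MeasurePreserving (fun x => x + fun i => (α i : UnitAddCircle)) ν ν)
    {n : Fin d → ℤ} (hn : n ≠ 0) : ∫ x, UnitAddTorus.mFourier n x ∂ν = 0 := by
  have h := hν.integral_comp (MeasurableEquiv.addRight _).measurableEmbedding
    (fun x => UnitAddTorus.mFourier n x)
  simp only [mFourier_add_apply, integral_mul_const] at h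
  by_contra h0
  exact mFourier_coe_ne_one hα hn (mul_left_cancel₀ h0 (h.trans (mul_one _).symm))

/-- Irrational torus translations are uniquely ergodic. -/
lemma eq_of_invariant_translation {d : ℕ} {α : Fin d → ℝ} (hα : RationallyIndependent α)
    {ν ρ : Measure (Torus d)} [IsFiniteMeasure ν] [IsFiniteMeasure ρ]
    (hν : MeasurePreserving (fun x => x + fun i => (α i : UnitAddCircle)) ν ν)
    (hρ : MeasurePreserving (fun x => x + fun i => (α i : UnitAddCircle)) ρ ρ)
    (hmass : ν Set.univ = ρ Set.univ) : ν = ρ := by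
  have hchar : ∀ n : Fin d → ℤ, ∫ x, UnitAddTorus.mFourier n x ∂ν =
      ∫ x, UnitAddTorus.mFourier n x ∂ρ := fun n => by
    by_cases hn : n = 0
    · subst hn
      simp [UnitAddTorus.mFourier_zero, Measure.real, hmass]
    · rw [integral_mFourier_eq_zero hα hν hn, integral_mFourier_eq_zero hα hρ hn]
  have hint : ∀ (μ : Measure (Torus d)) [IsFiniteMeasure μ] (g : C(Torus d, ℂ)),
      Integrable g μ := fun μ _ g => by
    refine Integrable.of_bound g.continuous.aestronglyMeasurable ‖g‖ (.of_forall fun x => ?_)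
    exact g.norm_coe_le_norm x
  refine ext_of_forall_mem_subalgebra_integral_eq_of_polish (𝕜 := ℂ)
    (A := (UnitAddTorus.mFourierSubalgebra (Fin d)).comap
      (BoundedContinuousFunction.toContinuousMapStarₐ ℂ)) ?_ fun g hg => ?_
  · have hmap : ((UnitAddTorus.mFourierSubalgebra (Fin d)).comap
        (BoundedContinuousFunction.toContinuousMapStarₐ ℂ)).map
          (BoundedContinuousFunction.toContinuousMapStarₐ ℂ) =
        UnitAddTorus.mFourierSubalgebra (Fin d) := by
      ext f
      simp only [StarSubalgebra.mem_map, StarSubalgebra.mem_comap]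
      refine ⟨fun ⟨g, hg, hgf⟩ => hgf ▸ hg, fun hf => ?_⟩
      exact ⟨BoundedContinuousFunction.mkOfCompact f, hf, rfl⟩
    rw [hmap]
    exact UnitAddTorus.mFourierSubalgebra_separatesPoints
  · have hg' : (BoundedContinuousFunction.toContinuousMapStarₐ ℂ g : C(Torus d, ℂ)) ∈
        Submodule.span ℂ (Set.range UnitAddTorus.mFourier) := by
      rw [← UnitAddTorus.mFourierSubalgebra_coe]
      exact hg
    have key : ∀ f ∈ Submodule.span ℂ (Set.range (UnitAddTorus.mFourier (d := Fin d))),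
        ∫ x, f x ∂ν = ∫ x, f x ∂ρ := fun f hf => by
      induction hf using Submodule.span_induction with
      | mem f hf => obtain ⟨n, rfl⟩ := hf; exact hchar n
      | zero => simp
      | add f g _ _ hf hg =>
        simp only [ContinuousMap.add_apply]
        rw [integral_add (hint ν f) (hint ν g), integral_add (hint ρ f) (hint ρ g), hf, hg]
      | smul c f _ hf => simp only [ContinuousMap.smul_apply, integral_smul, hf]
    exact key _ hg'

/-- A translation of the torus by a rationally independent vector is ergodic. -/
theorem ergodic_translation {d : ℕ} {α : Fin d → ℝ} (hα : RationallyIndependent α) :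
    Ergodic (fun x : Torus d => x + fun i => (α i : UnitAddCircle)) volume := by
  have hpres := measurePreserving_add_right (volume : Measure (Torus d))
    fun i => (α i : UnitAddCircle)
  refine ⟨hpres, ⟨fun s hs hinv => ?_⟩⟩
  have hres : MeasurePreserving (fun x : Torus d => x + fun i => (α i : UnitAddCircle))
      (volume.restrict s) (volume.restrict s) := by
    have := hpres.restrict_preimage hs
    rwa [hinv] at this
  have heq : volume.restrict s = volume s • (volume : Measure (Torus d)) := by
    have : IsFiniteMeasure (volume s • (volume : Measure (Torus d))) :=
      Measure.smul_finite _ (measure_ne_top _ _)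
    refine eq_of_invariant_translation hα hres (hpres.smul_measure _) ?_
    simp
  have h0 : volume s * volume sᶜ = 0 := by
    have := congrArg (fun μ : Measure (Torus d) => μ sᶜ) heq
    simpa [Measure.restrict_apply hs.compl] using this.symm
  rw [Filter.eventuallyConst_set']
  rcases mul_eq_zero.1 h0 with h | h
  · exact Or.inl (ae_eq_empty.2 h)
  · exact Or.inr (ae_eq_univ.2 h)

/-! ### Isomorphism of atomless standard Borel measure spaces -/

/-- Measurable equivalences between the fibres of two measurable labellings fit together to a
measurable equivalence; it preserves measures that are mapped into each other on every fibre. -/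
lemma exists_measurableEquiv_of_fibers {X Y ι : Type*} [MeasurableSpace X] [MeasurableSpace Y]
    [Countable ι] [MeasurableSpace ι] [MeasurableSingletonClass ι] {μ : Measure X} {ν : Measure Y}
    {f : X → ι} {g : Y → ι} (hf : Measurable f) (hg : Measurable g)
    (h : ∀ i, ∃ e : (f ⁻¹' {i}) ≃ᵐ (g ⁻¹' {i}),
      MeasurePreserving e (μ.comap Subtype.val) (ν.comap Subtype.val)) :
    ∃ e : X ≃ᵐ Y, MeasurePreserving e μ ν ∧ ∀ x, g (e x) = f x := by
  choose e he using h
  let E : X ≃ Y := (Equiv.sigmaPreimageEquiv f).symm.trans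
    ((Equiv.sigmaCongrRight fun i => (e i).toEquiv).trans (Equiv.sigmaPreimageEquiv g))
  have hE : ∀ x, E x = e (f x) ⟨x, rfl⟩ := fun x => rfl
  have hEs : ∀ y, E.symm y = (e (g y)).symm ⟨y, rfl⟩ := fun y => rfl
  have hfm : ∀ i, MeasurableSet (f ⁻¹' {i}) := fun i => hf (measurableSet_singleton i)
  have hgm : ∀ i, MeasurableSet (g ⁻¹' {i}) := fun i => hg (measurableSet_singleton i)
  have hpre : ∀ s : Set Y, E ⁻¹' s = ⋃ i, Subtype.val '' (e i ⁻¹' (Subtype.val ⁻¹' s)) := fun s => by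
    ext x
    simp only [Set.mem_preimage, Set.mem_iUnion, Set.mem_image, Subtype.exists]
    constructor
    · exact fun hx => ⟨f x, x, rfl, by rwa [hE] at hx, rfl⟩
    · rintro ⟨i, x', rfl, hx, rfl⟩
      rwa [hE]
  have hpres : ∀ s : Set X,
      E.symm ⁻¹' s = ⋃ i, Subtype.val '' ((e i).symm ⁻¹' (Subtype.val ⁻¹' s)) := fun s => by
    ext y
    simp only [Set.mem_preimage, Set.mem_iUnion, Set.mem_image, Subtype.exists]
    constructor
    · exact fun hy => ⟨g y, y, rfl, by rwa [hEs] at hy, rfl⟩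
    · rintro ⟨i, y', rfl, hy, rfl⟩
      rwa [hEs]
  have hEm : Measurable E := fun s hs => by
    rw [hpre]
    exact MeasurableSet.iUnion fun i =>
      (hfm i).subtype_image ((e i).measurable (measurable_subtype_coe hs))
  have hEsm : Measurable E.symm := fun s hs => by
    rw [hpres]
    exact MeasurableSet.iUnion fun i =>
      (hgm i).subtype_image ((e i).symm.measurable (measurable_subtype_coe hs))
  refine ⟨⟨E, hEm, hEsm⟩, ⟨hEm, ?_⟩, fun x => ?_⟩
  · ext s hs
    have hgs : s = ⋃ i, Subtype.val '' (Subtype.val ⁻¹' s : Set (g ⁻¹' {i})) := by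
      ext y; simp
    rw [MeasurableEquiv.coe_mk, Measure.map_apply hEm hs, hpre]
    conv_rhs => rw [hgs]
    rw [measure_iUnion, measure_iUnion]
    · refine tsum_congr fun i => ?_
      have h1 := (he i).measure_preimage_equiv (Subtype.val ⁻¹' s)
      rwa [comap_subtype_coe_apply (hfm i), comap_subtype_coe_apply (hgm i)] at h1
    · intro i j hij
      refine Set.disjoint_left.2 ?_
      rintro _ ⟨⟨x, hx⟩, -, rfl⟩ ⟨⟨x', hx'⟩, -, hxx'⟩
      exact hij (hx.symm.trans ((congrArg g hxx').symm.trans hx'))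
    · exact fun i => (hgm i).subtype_image (measurable_subtype_coe hs)
    · intro i j hij
      refine Set.disjoint_left.2 ?_
      rintro _ ⟨⟨x, hx⟩, -, rfl⟩ ⟨⟨x', hx'⟩, -, hxx'⟩
      exact hij (hx.symm.trans ((congrArg f hxx').symm.trans hx'))
    · exact fun i =>
        (hfm i).subtype_image ((e i).measurable (measurable_subtype_coe hs))
  · exact (e (f x) ⟨x, rfl⟩).2

/-- An uncountable standard Borel space with a finite measure has an uncountable null set: it is
isomorphic to the plane, and only countably many vertical lines have positive measure. -/
lemma exists_uncountable_null_set {X : Type*} [MeasurableSpace X] [StandardBorelSpace X]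
    [Uncountable X] (μ : Measure X) [IsFiniteMeasure μ] :
    ∃ s : Set X, MeasurableSet s ∧ μ s = 0 ∧ ¬ s.Countable := by
  have hX : ¬ Countable X := not_countable_iff.2 inferInstance
  have hR : ¬ Countable ℝ := not_countable_iff.2 inferInstance
  have hR2 : ¬ Countable (ℝ × ℝ) := not_countable_iff.2 inferInstance
  let e : X ≃ᵐ ℝ × ℝ := PolishSpace.measurableEquivOfNotCountable hX hR2
  have hm : ∀ t : ℝ, MeasurableSet ((fun x => (e x).1) ⁻¹' {t}) := fun t =>
    (measurable_fst.comp e.measurable) (measurableSet_singleton t)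
  have hc := Measure.countable_meas_pos_of_disjoint_iUnion (μ := μ) hm
    fun s t hst => Disjoint.preimage _ (Set.disjoint_singleton.2 hst)
  obtain ⟨t, ht⟩ : ∃ t : ℝ, t ∉ {t | 0 < μ ((fun x => (e x).1) ⁻¹' {t})} := by
    by_contra! h
    exact hR (Set.countable_univ_iff.1 (hc.mono fun t _ => h t))
  refine ⟨_, hm t, by simpa using ht, fun hcount => hR ?_⟩
  have himg := hcount.preimage_of_injOn (f := fun u : ℝ => e.symm (t, u))
    (fun u _ v _ huv => (Prod.ext_iff.1 (e.symm.injective huv)).2)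
  refine Set.countable_univ_iff.1 (himg.mono fun u _ => ?_)
  simp

/-- The quantile function of a probability measure on the real line. It is meaningful on `(0, 1)`;
elsewhere the infimum may be that of an empty or unbounded set, with the junk value `0`. -/
noncomputable def quantile (μ : Measure ℝ) (u : ℝ) : ℝ := sInf {x | u ≤ ProbabilityTheory.cdf μ x}

section Quantile

open ProbabilityTheory Set Filter

variable {μ : Measure ℝ} {u : ℝ}

lemma quantile_le_iff (hu : u ∈ Ioo (0 : ℝ) 1) (x : ℝ) : quantile μ u ≤ x ↔ u ≤ cdf μ x := by
  have hbdd : BddBelow {x | u ≤ cdf μ x} := by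
    obtain ⟨b, hb⟩ := ((tendsto_cdf_atBot μ).eventually_lt_const hu.1).exists
    exact ⟨b, fun y hy => le_of_not_gt fun hyb =>
      absurd (hy.trans (monotone_cdf μ hyb.le)) (not_le.2 hb)⟩
  have hne : {x | u ≤ cdf μ x}.Nonempty := by
    obtain ⟨b, hb⟩ := ((tendsto_cdf_atTop μ).eventually_const_lt hu.2).exists
    exact ⟨b, hb.le⟩
  refine ⟨fun h => ?_, fun h => csInf_le hbdd h⟩
  refine le_trans ?_ (monotone_cdf μ h)
  -- right continuity of the distribution function
  have hlim : Tendsto (cdf μ) (nhdsWithin (quantile μ u) (Ioi (quantile μ u)))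
      (nhds (cdf μ (quantile μ u))) :=
    ((cdf μ).right_continuous _).mono Ioi_subset_Ici_self
  refine ge_of_tendsto hlim ?_
  filter_upwards [self_mem_nhdsWithin] with y hy
  obtain ⟨z, hz, hzy⟩ := exists_lt_of_csInf_lt hne hy
  exact hz.trans (monotone_cdf μ hzy.le)

variable [IsProbabilityMeasure μ]

/-- Without atoms the distribution function is continuous, and the quantile function is a right
inverse of it. -/
lemma cdf_quantile [NullSingletonClass μ] (hu : u ∈ Ioo (0 : ℝ) 1) :
    cdf μ (quantile μ u) = u := by
  refine le_antisymm ?_ ((quantile_le_iff hu _).1 le_rfl)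
  have hleft : Function.leftLim (cdf μ) (quantile μ u) = cdf μ (quantile μ u) := by
    have h := (cdf μ).measure_singleton (quantile μ u)
    rw [measure_cdf, measure_singleton, eq_comm, ENNReal.ofReal_eq_zero, sub_nonpos] at h
    exact le_antisymm ((monotone_cdf μ).leftLim_le le_rfl) h
  rw [← hleft]
  refine le_of_tendsto ((monotone_cdf μ).tendsto_leftLim _) ?_
  filter_upwards [self_mem_nhdsWithin] with y hy
  exact le_of_not_ge fun h => absurd ((quantile_le_iff hu y).2 h) (not_le.2 hy)

lemma measurable_quantile_restrict (μ : Measure ℝ) :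
    Measurable fun u : Ioo (0 : ℝ) 1 => quantile μ u := by
  refine measurable_of_Iic fun x => ?_
  have : (fun u : Ioo (0 : ℝ) 1 => quantile μ u) ⁻¹' Iic x = Subtype.val ⁻¹' Iic (cdf μ x) := by
    ext u
    exact quantile_le_iff u.2 x
  rw [this]
  exact measurable_subtype_coe measurableSet_Iic

/-- The quantile function maps Lebesgue measure on the unit interval to the given measure. -/
lemma map_quantile (μ : Measure ℝ) [IsProbabilityMeasure μ] :
    ((volume : Measure ℝ).comap (Subtype.val : Ioo (0 : ℝ) 1 → ℝ)).map
      (fun u : Ioo (0 : ℝ) 1 => quantile μ u) = μ := by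
  symm
  refine Measure.ext_of_Iic _ _ fun x => ?_
  have : (fun u : Ioo (0 : ℝ) 1 => quantile μ u) ⁻¹' Iic x = Subtype.val ⁻¹' Iic (cdf μ x) := by
    ext u
    exact quantile_le_iff u.2 x
  rw [Measure.map_apply (measurable_quantile_restrict μ) measurableSet_Iic, this,
    comap_subtype_coe_apply measurableSet_Ioo, Subtype.image_preimage_coe, ← ofReal_cdf]
  have h0 : (Ioo (0 : ℝ) 1 ∩ Iic (cdf μ x) : Set ℝ) =ᵐ[volume] (Ioc 0 (cdf μ x) : Set ℝ) := by
    have : Ioc (0 : ℝ) 1 ∩ Iic (cdf μ x) = Ioc 0 (cdf μ x) := by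
      rw [Ioc_inter_Iic, min_eq_right (cdf_le_one μ x)]
    rw [← this]
    exact ae_eq_set_inter Ioo_ae_eq_Ioc Filter.EventuallyEq.rfl
  rw [measure_congr h0, Real.volume_Ioc, sub_zero]

end Quantile

/-- An atomless standard Borel probability space is isomorphic to the unit interval. The quantile
function embeds the interval with a null complement of the range; the isomorphism follows it off an
uncountable null set, and maps this null set to the rest, which is an uncountable null set too. -/
lemma exists_measurableEquiv_unitInterval {X : Type*} [MeasurableSpace X] [StandardBorelSpace X]
    (μ : Measure X) [IsProbabilityMeasure μ] [NullSingletonClass μ] :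
    ∃ e : Set.Ioo (0 : ℝ) 1 ≃ᵐ X,
      MeasurePreserving e ((volume : Measure ℝ).comap Subtype.val) μ := by
  have hX : ¬ Countable X := fun h => by
    have := (Set.countable_univ (α := X)).measure_zero μ
    simp at this
  have hR : ¬ Countable ℝ := not_countable_iff.2 inferInstance
  let b : X ≃ᵐ ℝ := PolishSpace.measurableEquivOfNotCountable hX hR
  have hprob : IsProbabilityMeasure (μ.map b) :=
    Measure.isProbabilityMeasure_map b.measurable.aemeasurable
  have hatom : NullSingletonClass (μ.map b) := ⟨fun x => by
    rw [b.map_apply, show b ⁻¹' {x} = {b.symm x} by ext; simp [b.eq_symm_apply]]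
    exact measure_singleton _⟩
  set lam : Measure (Set.Ioo (0 : ℝ) 1) := (volume : Measure ℝ).comap Subtype.val with hlam
  have hstd : StandardBorelSpace (Set.Ioo (0 : ℝ) 1) := measurableSet_Ioo.standardBorel
  let G : Set.Ioo (0 : ℝ) 1 → X := fun u => b.symm (quantile (μ.map b) u)
  have hGm : Measurable G := b.symm.measurable.comp (measurable_quantile_restrict _)
  have hGmap : lam.map G = μ := by
    have h := congrArg (Measure.map b.symm) (map_quantile (μ.map b))
    rwa [Measure.map_map b.symm.measurable (measurable_quantile_restrict _),
      MeasurableEquiv.map_symm_map] at h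
  have hGinj : Function.Injective G := fun u v huv => by
    have h := b.symm.injective huv
    exact Subtype.ext ((cdf_quantile u.2).symm.trans
      ((congrArg (ProbabilityTheory.cdf (μ.map b)) h).trans (cdf_quantile v.2)))
  have hGe : MeasurableEmbedding G := hGm.measurableEmbedding hGinj
  have hunc : Uncountable (Set.Ioo (0 : ℝ) 1) :=
    not_countable_iff.1 fun h => absurd (Cardinal.Real.Ioo_countable_iff.1 h) (not_le.2 zero_lt_one)
  have hlamfin : IsFiniteMeasure lam := ⟨by
    rw [hlam, comap_subtype_coe_apply measurableSet_Ioo, Set.image_univ, Subtype.range_coe]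
    exact measure_Ioo_lt_top⟩
  obtain ⟨C, hCm, hC0, hCc⟩ := exists_uncountable_null_set lam
  let k : (Cᶜ : Set (Set.Ioo (0 : ℝ) 1)) → X := fun u => G u
  have hk : MeasurableEmbedding k := hGe.comp (MeasurableEmbedding.subtype_coe hCm.compl)
  have hS : MeasurableSet (Set.range k)ᶜ := hk.measurableSet_range.compl
  have hpreim : G ⁻¹' (Set.range k)ᶜ = C := by
    ext u
    simp only [Set.mem_preimage, Set.mem_compl_iff, Set.mem_range, k, Subtype.exists, exists_prop,
      hGinj.eq_iff, exists_eq_right, not_not]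
  have hnull : μ (Set.range k)ᶜ = 0 := by
    rw [← hGmap, Measure.map_apply hGm hS, hpreim, hC0]
  have hrest : ¬ ((Set.range k)ᶜ).Countable := fun h => hCc (by
    rw [← hpreim]; exact h.preimage_of_injOn hGinj.injOn)
  refine (exists_measurableEquiv_of_fibers (μ := lam) (ν := μ)
    (f := fun u => (u ∈ C : Prop)) (g := fun x => (x ∈ (Set.range k)ᶜ : Prop))
    (measurable_mem.2 hCm) (measurable_mem.2 hS) fun i => ?_).imp fun e he => he.1
  by_cases hi : i
  · obtain rfl : i = True := eq_true hi
    rw [show (fun u => (u ∈ C : Prop)) ⁻¹' {True} = C by ext; simp,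
      show (fun x => (x ∈ (Set.range k)ᶜ : Prop)) ⁻¹' {True} = (Set.range k)ᶜ by ext; simp]
    have := hCm.standardBorel
    have := hS.standardBorel
    refine ⟨PolishSpace.measurableEquivOfNotCountable hCc hrest, MeasurableEquiv.measurable _, ?_⟩
    have h1 : lam.comap (Subtype.val : C → _) = 0 := by
      rw [← Measure.measure_univ_eq_zero, comap_subtype_coe_apply hCm]
      rwa [Set.image_univ, Subtype.range_coe]
    have h2 : μ.comap (Subtype.val : ((Set.range k)ᶜ : Set X) → _) = 0 := by
      rw [← Measure.measure_univ_eq_zero, comap_subtype_coe_apply hS]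
      rwa [Set.image_univ, Subtype.range_coe]
    rw [h1, h2, Measure.map_zero]
  · obtain rfl : i = False := eq_false hi
    rw [show (fun u => (u ∈ C : Prop)) ⁻¹' {False} = Cᶜ by ext; simp,
      show (fun x => (x ∈ (Set.range k)ᶜ : Prop)) ⁻¹' {False} = Set.range k by
        ext x; simp [-Set.mem_range]]
    refine ⟨hk.equivRange, MeasurableEquiv.measurable _, ?_⟩
    ext s hs
    have hkr : ∀ c, hk.equivRange c = ⟨k c, c, rfl⟩ := fun c => by
      rw [← MeasurableEquiv.eq_symm_apply, hk.equivRange_symm_apply_mk]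
    have himg : Subtype.val '' (hk.equivRange ⁻¹' s) = G ⁻¹' (Subtype.val '' s) := by
      ext u
      constructor
      · rintro ⟨c, hc, rfl⟩
        exact ⟨_, hc, congrArg Subtype.val (hkr c)⟩
      · rintro ⟨⟨_, c, rfl⟩, hr, hru⟩
        exact ⟨c, by rwa [Set.mem_preimage, hkr], hGinj hru⟩
    rw [MeasurableEquiv.map_apply, comap_subtype_coe_apply hCm.compl,
      comap_subtype_coe_apply hk.measurableSet_range, himg]
    conv_rhs => rw [← hGmap]
    rw [Measure.map_apply hGm (hk.measurableSet_range.subtype_image hs)]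

/-- Two atomless finite measures on standard Borel spaces with the same positive mass are
isomorphic. -/
theorem exists_measurableEquiv_of_measure_univ_eq {X Y : Type*} [MeasurableSpace X]
    [StandardBorelSpace X] [MeasurableSpace Y] [StandardBorelSpace Y] (μ : Measure X)
    (ν : Measure Y) [NullSingletonClass μ] [NullSingletonClass ν]
    (h : μ Set.univ = ν Set.univ) (h0 : μ Set.univ ≠ 0) (htop : μ Set.univ ≠ ⊤) :
    ∃ e : X ≃ᵐ Y, MeasurePreserving e μ ν := by
  have hμ : IsProbabilityMeasure ((μ Set.univ)⁻¹ • μ) :=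
    ⟨by simpa using ENNReal.inv_mul_cancel h0 htop⟩
  have hν : IsProbabilityMeasure ((μ Set.univ)⁻¹ • ν) :=
    ⟨by simpa [← h] using ENNReal.inv_mul_cancel h0 htop⟩
  have hμa : NullSingletonClass ((μ Set.univ)⁻¹ • μ) := ⟨fun x => by simp⟩
  have hνa : NullSingletonClass ((μ Set.univ)⁻¹ • ν) := ⟨fun x => by simp⟩
  obtain ⟨e, he⟩ := exists_measurableEquiv_unitInterval ((μ Set.univ)⁻¹ • μ)
  obtain ⟨e', he'⟩ := exists_measurableEquiv_unitInterval ((μ Set.univ)⁻¹ • ν)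
  have hpres := ((he.symm e).trans he').smul_measure (μ Set.univ)
  rw [smul_smul, smul_smul, ENNReal.mul_inv_cancel h0 htop, one_smul, one_smul] at hpres
  exact ⟨e.symm.trans e', hpres⟩

/-! ### Transport of the torus partition -/

/-- A rationally independent tuple of probabilities has positive members and its sum is less
than `1`. -/
lemma RationallyIndependent.pos_and_sum_lt_one {d : ℕ} {α : Fin d → ℝ}
    (hα : RationallyIndependent α) (h0 : ∀ i, 0 ≤ α i) (h1 : ∑ i, α i ≤ 1) :
    (∀ i, 0 < α i) ∧ ∑ i, α i < 1 := by
  refine ⟨fun i => (h0 i).lt_of_ne' (hα.ne_zero i.succ), h1.lt_of_ne fun h => ?_⟩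
  have := Fintype.linearIndependent_iff.1 hα (Fin.cons (-1) fun _ => 1) (by
    rw [Fin.sum_univ_succ]; simp [h]) 0
  simp at this

/-- A finite family of disjoint null-measurable sets that covers almost everything is, up to null
sets, given by the fibres of a measurable labelling. -/
lemma exists_measurable_label {X : Type*} [MeasurableSpace X] {p : Measure X}
    [IsProbabilityMeasure p] {n : ℕ} {A : Fin (n + 1) → Set X}
    (hA : ∀ i, NullMeasurableSet (A i) p) (hdisj : Pairwise fun i j => Disjoint (A i) (A j))
    (hcover : p (⋃ i, A i) = 1) :
    ∃ l : X → Fin (n + 1), Measurable l ∧ ∀ᵐ x ∂p, ∀ i, x ∈ A i ↔ l x = i := by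
  classical
  choose B hBA hBm hBae using fun i => (hA i).exists_measurable_subset_ae_eq
  have hBd : ∀ i j x, x ∈ B i → x ∈ B j → i = j := fun i j x hi hj => by
    by_contra hij
    exact Set.disjoint_left.1 (hdisj hij) (hBA i hi) (hBA j hj)
  let l : X → Fin (n + 1) := fun x => if h : ∃ i, x ∈ B i then h.choose else 0
  have hl : ∀ i x, x ∈ B i → l x = i := fun i x hx => by
    have h : ∃ i, x ∈ B i := ⟨i, hx⟩
    simp only [l, dif_pos h]
    exact hBd _ _ x h.choose_spec hx
  have hlpre : ∀ i, l ⁻¹' {i} = B i ∪ ((⋃ j, B j)ᶜ ∩ {_x | i = 0}) := fun i => by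
    ext x
    simp only [Set.mem_preimage, Set.mem_singleton_iff, Set.mem_union, Set.mem_inter_iff,
      Set.mem_compl_iff, Set.mem_iUnion, Set.mem_ofPred_eq]
    constructor
    · intro h
      by_cases hx : ∃ j, x ∈ B j
      · obtain ⟨j, hj⟩ := hx
        exact Or.inl (h ▸ hl j x hj ▸ hj)
      · refine Or.inr ⟨hx, ?_⟩
        simpa only [l, dif_neg hx, eq_comm] using h
    · rintro (h | ⟨h, rfl⟩)
      · exact hl i x h
      · simp only [l, dif_neg h]
  refine ⟨l, measurable_to_countable' fun i => ?_, ?_⟩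
  · rw [hlpre]
    exact (hBm i).union ((MeasurableSet.iUnion hBm).compl.inter (MeasurableSet.const _))
  · have hcov : ∀ᵐ x ∂p, x ∈ ⋃ i, A i :=
      (prob_compl_eq_zero_iff₀ (NullMeasurableSet.iUnion hA)).2 hcover
    have hae : ∀ᵐ x ∂p, ∀ i, x ∈ B i ↔ x ∈ A i :=
      ae_all_iff.2 fun i => (hBae i).mem_iff
    filter_upwards [hcov, hae] with x hx hB i
    rw [← hB]
    refine ⟨hl i x, fun h => ?_⟩
    obtain ⟨j, hj⟩ := Set.mem_iUnion.1 hx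
    exact h ▸ hl j x ((hB j).2 hj) ▸ (hB j).2 hj

/-- Two atomless probability measures on standard Borel spaces with labellings of the same
distribution, charging every label, are isomorphic by a map that respects the labels. -/
lemma exists_measurableEquiv_of_labels {X Y ι : Type*} [MeasurableSpace X] [StandardBorelSpace X]
    [MeasurableSpace Y] [StandardBorelSpace Y] [Countable ι] [MeasurableSpace ι]
    [MeasurableSingletonClass ι] {μ : Measure X} {ν : Measure Y} [IsFiniteMeasure μ]
    [NullSingletonClass μ] [NullSingletonClass ν] {f : X → ι} {g : Y → ι} (hf : Measurable f)
    (hg : Measurable g) (h0 : ∀ i, μ (f ⁻¹' {i}) ≠ 0)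
    (h : ∀ i, μ (f ⁻¹' {i}) = ν (g ⁻¹' {i})) :
    ∃ e : X ≃ᵐ Y, MeasurePreserving e μ ν ∧ ∀ x, g (e x) = f x := by
  refine exists_measurableEquiv_of_fibers hf hg fun i => ?_
  have hfm := hf (measurableSet_singleton i)
  have hgm := hg (measurableSet_singleton i)
  have := hfm.standardBorel
  have := hgm.standardBorel
  have hμ : NullSingletonClass (μ.comap (Subtype.val : f ⁻¹' {i} → X)) := ⟨fun x => by
    rw [comap_subtype_coe_apply hfm, Set.image_singleton, measure_singleton]⟩
  have hν : NullSingletonClass (ν.comap (Subtype.val : g ⁻¹' {i} → Y)) := ⟨fun x => by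
    rw [comap_subtype_coe_apply hgm, Set.image_singleton, measure_singleton]⟩
  have hmass : μ.comap (Subtype.val : f ⁻¹' {i} → X) Set.univ = μ (f ⁻¹' {i}) := by
    rw [comap_subtype_coe_apply hfm, Set.image_univ, Subtype.range_coe]
  have hmass' : ν.comap (Subtype.val : g ⁻¹' {i} → Y) Set.univ = ν (g ⁻¹' {i}) := by
    rw [comap_subtype_coe_apply hgm, Set.image_univ, Subtype.range_coe]
  refine exists_measurableEquiv_of_measure_univ_eq _ _ ?_ ?_ ?_
  · rw [hmass, hmass', h]
  · rw [hmass]; exact h0 i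
  · rw [hmass]; exact measure_ne_top _ _

/-- The measures of the fibres of a labelling by `Fin (n + 1)` sum to `1`. -/
lemma sum_measureReal_fibers {X : Type*} [MeasurableSpace X] (μ : Measure X)
    [IsProbabilityMeasure μ] {n : ℕ} {l : X → Fin (n + 1)} (hl : Measurable l) :
    ∑ i : Fin n, μ.real (l ⁻¹' {i.castSucc}) + μ.real (l ⁻¹' {Fin.last n}) = 1 := by
  rw [← Fin.sum_univ_castSucc (fun i => μ.real (l ⁻¹' {i})),
    sum_measureReal_preimage_singleton _ fun i _ => hl (measurableSet_singleton i)]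
  simp

/-- If the indicator function of a set minus a constant is a bounded coboundary, then the constant
is the measure of the set. -/
lemma measureReal_eq_of_coboundary {Y : Type*} [MeasurableSpace Y] {ν : Measure Y}
    [IsProbabilityMeasure ν] {T : Y ≃ᵐ Y} (hT : MeasurePreserving T ν ν) {s : Set Y}
    (hs : MeasurableSet s) {c : ℝ} {h : Y → ℝ} (hh : Integrable h ν)
    (heq : ∀ y, s.indicator (1 : Y → ℝ) y = c + h y - h (T y)) : ν.real s = c := by
  have hhT : Integrable (fun y => h (T y)) ν := hT.integrable_comp_of_integrable hh
  have h1 : ∫ y, h (T y) ∂ν = ∫ y, h y ∂ν := hT.integral_comp' h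
  have hc : Integrable (fun _ : Y => c) ν := integrable_const c
  have hadd : ∫ y, (c + h y) ∂ν = ∫ _, c ∂ν + ∫ y, h y ∂ν := integral_add hc hh
  have hsub : ∫ y, (c + h y - h (T y)) ∂ν = ∫ y, (c + h y) ∂ν - ∫ y, h (T y) ∂ν :=
    integral_sub (hc.add hh) hhT
  rw [← integral_indicator_one hs, integral_congr_ae (.of_forall heq), hsub, hadd, h1]
  simp

/-- A function of a label is an affine combination of the indicators of all labels but the last. -/
lemma apply_label_eq_add_sum_indicator {Z : Type*} {d : ℕ} (a : Fin (d + 1) → ℝ)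
    (l : Z → Fin (d + 1)) (z : Z) :
    a (l z) = a (Fin.last d) + ∑ i : Fin d, (a i.castSucc - a (Fin.last d)) *
      (l ⁻¹' {i.castSucc}).indicator (1 : Z → ℝ) z := by
  classical
  simp only [Set.indicator_apply, Set.mem_preimage, Set.mem_singleton_iff, Pi.one_apply]
  generalize l z = j
  refine Fin.lastCases ?_ (fun j => ?_) j
  · simp [(Fin.castSucc_lt_last _).ne']
  · simp

theorem mainTheorem3
    {X : Type*} [MeasurableSpace X] [StandardBorelSpace X]
    (p : Measure X) [IsProbabilityMeasure p] [NullSingletonClass p]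
    -- `m = d + 1` is the number of steps, `d = m - 1` the dimension of the torus
    (d : ℕ) (hd : 1 ≤ d)
    (A : Fin (d + 1) → Set X) (a : Fin (d + 1) → ℝ)
    (hA : ∀ i, NullMeasurableSet (A i) p)
    (hdisj : Pairwise fun i j => Disjoint (A i) (A j))
    (hcover : p (⋃ i, A i) = 1)
    (f : X → ℝ)
    (hf : ∀ᵐ x ∂p, f x = ∑ i, (A i).indicator (fun _ => a i) x)
    (hmean : ∫ x, f x ∂p = 0)
    (hindep : RationallyIndependent fun i : Fin d => p.real (A i.castSucc)) :
    ∃ τ : X ≃ᵐ X,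
      Ergodic τ p ∧
      (∃ θ : Torus d,
        IsIsomorphicMod0 p τ (volume : Measure (Torus d)) (fun x => x + θ)) ∧
      IsCoboundary p τ ⊤ f := by
  classical
  have : Nonempty (Fin d) := ⟨⟨0, hd⟩⟩
  obtain ⟨l, hl, hlA⟩ := exists_measurable_label hA hdisj hcover
  have hpl : ∀ i, p.real (A i) = p.real (l ⁻¹' {i}) := fun i =>
    measureReal_congr (Filter.eventuallyEq_set.2 (hlA.mono fun x hx => hx i))
  simp only [hpl] at hindep
  set α : Fin d → ℝ := fun i => p.real (l ⁻¹' {i.castSucc}) with hα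
  have hsum := sum_measureReal_fibers p hl
  obtain ⟨hpos, hlt⟩ := hindep.pos_and_sum_lt_one (fun i => measureReal_nonneg) (by
    linarith [measureReal_nonneg (μ := p) (s := l ⁻¹' {Fin.last d})])
  obtain ⟨ℓ, h, hℓ, hhm, hhb, hhℓ⟩ := exists_bounded_remainder_partition α hpos hlt.le
  let T : Torus d ≃ᵐ Torus d := MeasurableEquiv.addRight fun i => (α i : UnitAddCircle)
  have hTerg : Ergodic T volume := ergodic_translation hindep
  have hhint : ∀ i, Integrable (h i) := fun i => by
    obtain ⟨C, hC⟩ := hhb i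
    exact Integrable.of_bound (hhm i).aestronglyMeasurable C (.of_forall hC)
  have hvol : ∀ i : Fin d, (volume : Measure (Torus d)).real (ℓ ⁻¹' {i.castSucc}) = α i :=
    fun i => measureReal_eq_of_coboundary hTerg.toMeasurePreserving
      (hℓ (measurableSet_singleton _)) (hhint i) (hhℓ i)
  have hsum' := sum_measureReal_fibers (volume : Measure (Torus d)) hℓ
  simp only [hvol] at hsum'
  have hmass : ∀ i, p.real (l ⁻¹' {i}) = (volume : Measure (Torus d)).real (ℓ ⁻¹' {i}) := fun i => by
    refine Fin.lastCases ?_ (fun i => (hvol i).symm) i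
    linarith
  have hmass0 : ∀ i, p (l ⁻¹' {i}) ≠ 0 := fun i h0 => by
    have h0' : p.real (l ⁻¹' {i}) = 0 := by simp [Measure.real, h0]
    revert h0'
    refine Fin.lastCases (fun h => by linarith) (fun i => (hpos i).ne') i
  obtain ⟨φ, hφ, hφl⟩ := exists_measurableEquiv_of_labels hl hℓ hmass0 fun i =>
    (measureReal_eq_measureReal_iff).1 (hmass i)
  -- the label of `x` determines `f x` almost everywhere
  have hfl : ∀ᵐ x ∂p, f x = a (l x) := by
    filter_upwards [hf, hlA] with x hx hlx
    rw [hx, Finset.sum_eq_single (l x)]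
    · exact Set.indicator_of_mem ((hlx _).2 rfl) _
    · exact fun i _ hi => Set.indicator_of_notMem (fun hxi => hi ((hlx i).1 hxi).symm) _
    · simp
  have hmean' : a (Fin.last d) + ∑ i : Fin d, (a i.castSucc - a (Fin.last d)) * α i = 0 := by
    rw [← hmean, integral_congr_ae hfl, integral_congr_ae (.of_forall fun x => apply_label_eq_add_sum_indicator a l x)]
    have hm : ∀ i : Fin d, MeasurableSet (l ⁻¹' {i.castSucc}) := fun i =>
      hl (measurableSet_singleton _)
    have hi : ∀ i : Fin d, Integrable ((l ⁻¹' {i.castSucc}).indicator (1 : X → ℝ)) p := fun i =>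
      (integrable_indicator_iff (hm i)).2 (integrable_const (1 : ℝ)).integrableOn
    rw [integral_add (integrable_const _)
      (integrable_finsetSum _ fun i _ => (hi i).const_mul _),
      integral_finsetSum _ fun i _ => (hi i).const_mul _]
    simp [integral_const_mul, integral_indicator_one (hm _), hα]
  let H : Torus d → ℝ := fun y => ∑ i : Fin d, (a i.castSucc - a (Fin.last d)) * h i y
  have hHm : Measurable H := Finset.measurable_sum _ fun i _ => (hhm i).const_mul _
  have hHcob : ∀ y, a (ℓ y) = H y - H (T y) := fun y => by
    rw [apply_label_eq_add_sum_indicator a ℓ]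
    simp only [hhℓ]
    have : ∀ i : Fin d, (a i.castSucc - a (Fin.last d)) *
        (α i + h i y - h i (y + fun j => (α j : UnitAddCircle))) =
        (a i.castSucc - a (Fin.last d)) * α i + ((a i.castSucc - a (Fin.last d)) * h i y -
          (a i.castSucc - a (Fin.last d)) * h i (T y)) := fun i => by
      simp only [T, MeasurableEquiv.coe_addRight]; ring
    rw [Finset.sum_congr rfl fun i _ => this i, Finset.sum_add_distrib, Finset.sum_sub_distrib,
      ← add_assoc, hmean', zero_add]
  choose C hC using hhb
  have hHb : ∀ y, ‖H y‖ ≤ ∑ i : Fin d, |a i.castSucc - a (Fin.last d)| * C i := fun y =>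
    (Finset.abs_sum_le_sum_abs _ _).trans (Finset.sum_le_sum fun i _ => by
      rw [abs_mul]; exact mul_le_mul_of_nonneg_left (hC i y) (abs_nonneg _))
  refine ⟨(φ.trans T).trans φ.symm, ?_, ⟨fun i => (α i : UnitAddCircle), φ, φ.symm, hφ,
    hφ.symm φ, .of_forall φ.symm_apply_apply, .of_forall φ.apply_symm_apply,
    .of_forall fun x => φ.apply_symm_apply _⟩, fun x => H (φ x), ?_, ?_⟩
  · exact (hφ.symm φ).ergodic_conjugate_iff.2 hTerg
  · exact memLp_top_of_bound (hHm.comp φ.measurable).aestronglyMeasurable _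
      (.of_forall fun x => hHb _)
  · filter_upwards [hfl] with x hx
    rw [hx, ← hφl, hHcob]
    exact congrArg (fun y => H (φ x) - H y) (φ.apply_symm_apply _).symm
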